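/- **Proposition.** Infinite words are indexed by $\mathbb N=\{0,1,2,\dots\}$, and $\mathcal L(x)$ denotes the set of finite factors (blocks of consecutive letters) of an infinite word $x$. Two finite words are abelian equivalent, $u\sim_{\mathrm{ab}}v$, if every letter occurs equally often in both. For $x\in\Sigma^{\mathbb N}$ put $$\mathcal A(x)=\{y\in\Sigma^{\mathbb N}:\ \forall u\in\mathcal L(y)\ \exists v\in\mathcal L(x),\ u\sim_{\mathrm{ab}}v\},\qquad \Omega(x)=\{y\in\Sigma^{\mathbb N}:\ \mathcal L(y)\subseteq\mathcal L(x)\}$$ (the abelian closure and the shift orbit closure of $x$). A subshift is a nonempty subset of $\Sigma^{\mathbb N}$ that is closed in the product topology ($\Sigma$ being discrete) and is mapped into itself by the shift $a_0a_1a_2\cdots\mapsto a_1a_2\cdots$; it is minimal if it contains no subshift other than itself. An infinite word is periodic if it is of the form $v^\omega=vvv\cdots$ with $v$ a nonempty finite word. A Sturmian word is a rotation word of irrational slope: a word $s\in\{0,1\}^{\mathbb N}$ for which there are an irrational $\alpha\in[0,1)$ and $\rho\in[0,1)$ such that either, for all $n$, $s_n=1$ iff $\{\rho+n\alpha\}\in[1-\alpha,1)$,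 or, for all $n$, $s_n=1$ iff $\{\rho+n\alpha\}\in(1-\alpha,1)\cup\{0\}$, where $\{\cdot\}$ is the fractional part. For a binary word $s$ and infinite words $z_0,z_1$, let $\mathcal S(s,z_0,z_1)$ be the word obtained from $s$ by replacing, for every $n$, the $n$-th occurrence of $0$ (resp. $1$) in $s$ by the $n$-th letter of $z_0$ (resp. $z_1$). Let $A,B\subseteq\Sigma$ be disjoint alphabets, let $s$ be a Sturmian word, let $z_0\in A^{\mathbb N}$ and $z_1\in B^{\mathbb N}$ be periodic words, and let $u=\mathcal S(s,z_0,z_1)$. Then $$\mathcal A(u)=\bigcup_{t_0\in\mathcal A(z_0),\ t_1\in\mathcal A(z_1)}\Omega\big(\mathcal S(s,t_0,t_1)\big),$$ and $\mathcal A(u)$ is a union of finitely many minimal subshifts. -/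

import Mathlib

noncomputable section

namespace InfWord

/-- The block `x_i x_{i+1} ⋯ x_{i+n-1}` of length `n` of the infinite word `x`. -/
def block {α : Type*} (x : ℕ → α) (i n : ℕ) : List α :=
  List.ofFn (fun k : Fin n => x (i + k))

/-- The set of (finite) factors of the infinite word `x`. -/
def language {α : Type*} (x : ℕ → α) : Set (List α) :=
  {w | ∃ i n : ℕ, w = block x i n}

/-- Two finite words are abelian equivalent if each letter occurs equally often in both. -/
def AbelianEquiv {α : Type*} (u v : List α) : Prop :=
  open Classical in ∀ a : α, u.count a = v.count a

theorem abelianEquiv_iff_perm {α : Type*} (u v : List α) : AbelianEquiv u v ↔ u.Perm v := by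
  classical
  rw [List.perm_iff_count]
  unfold AbelianEquiv
  constructor
  · intro h a
    convert h a
  · intro h a
    convert h a

/-- The abelian closure of the infinite word `x`: all infinite words `y` each of whose factors
is abelian equivalent to some factor of `x`. -/
def abelianClosure {α : Type*} (x : ℕ → α) : Set (ℕ → α) :=
  {y | ∀ u ∈ language y, ∃ v ∈ language x, AbelianEquiv u v}

/-- The shift orbit closure of the infinite word `x`: all infinite words `y` each of whose
factors is a factor of `x`. -/
def orbitClosure {α : Type*} (x : ℕ → α) : Set (ℕ → α) :=
  {y | language y ⊆ language x}

/-- The shift operator, deleting the first letter. -/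
def shift {α : Type*} (x : ℕ → α) : ℕ → α := fun n => x (n + 1)

/-- A subshift: a nonempty, closed (for the product topology) set of infinite words that the
shift operator maps into itself. -/
structure IsSubshift {α : Type*} [TopologicalSpace α] (X : Set (ℕ → α)) : Prop where
  nonempty : X.Nonempty
  isClosed : IsClosed X
  shift_mem : ∀ x ∈ X, shift x ∈ X

/-- A minimal subshift: a subshift that contains no subshift other than itself. -/
def IsMinimalSubshift {α : Type*} [TopologicalSpace α] (X : Set (ℕ → α)) : Prop :=
  IsSubshift X ∧ ∀ Y : Set (ℕ → α), IsSubshift Y → Y ⊆ X → Y = X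

/-- A periodic infinite word `v^ω` with `v` a nonempty finite word. -/
def IsPeriodic {α : Type*} (x : ℕ → α) : Prop :=
  ∃ p : ℕ, 0 < p ∧ Function.Periodic x p

/-- The rotation word of slope `a` and intercept `r` for the partition of the circle into
`[0, 1 - a)` (letter `0`) and `[1 - a, 1)` (letter `1`); the `n`-th point of the orbit of `r`
under the rotation by `a` is the fractional part of `r + n * a`. -/
def lowerRotationWord (a r : ℝ) : ℕ → Fin 2 := fun n =>
  if 1 - a ≤ Int.fract (r + n * a) then 1 else 0

/-- The rotation word of slope `a` and intercept `r` for the partition of the circle into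
`(0, 1 - a]` (letter `0`) and `(1 - a, 1]` (letter `1`); the endpoint `1` is the point `0`
of the circle. -/
def upperRotationWord (a r : ℝ) : ℕ → Fin 2 := fun n =>
  if 1 - a < Int.fract (r + n * a) ∨ Int.fract (r + n * a) = 0 then 1 else 0

/-- A Sturmian word: a rotation word of irrational slope (equivalently, an aperiodic rotation
word), for either choice of the endpoints. -/
def IsSturmian (s : ℕ → Fin 2) : Prop :=
  ∃ a r : ℝ, Irrational a ∧ a ∈ Set.Ico (0 : ℝ) 1 ∧ r ∈ Set.Ico (0 : ℝ) 1 ∧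
    (s = lowerRotationWord a r ∨ s = upperRotationWord a r)

/-- The word obtained from the binary word `x` by replacing the `n`-th occurrence of `0`
by the `n`-th letter of `z₀` and the `n`-th occurrence of `1` by the `n`-th letter of `z₁`. -/
def substitute {α : Type*} (x : ℕ → Fin 2) (z₀ z₁ : ℕ → α) : ℕ → α := fun n =>
  if x n = 0 then z₀ (Nat.count (fun i => x i = 0) n)
  else z₁ (Nat.count (fun i => x i = 1) n)

end InfWord

end

/-!
Both inclusions and the minimality rest on one property of balanced words of a fixed irrational
slope `a`: two such words `s` and `x` have the same factors, and every factor of `x` occurs in `s`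
with bounded gaps at positions `j` for which the numbers of letters `0` and `1` before `j` lie in
prescribed residue classes. Up to a bounded error the number of letters `1` before `j` is `j * a`,
so such an occurrence is a visit to an open arc by an irrational rotation of a circle whose length
is a common multiple of the moduli.

Choosing the residues suitably realizes, for `t₀` and `t₁` in the abelian closures of `z₀` and `z₁`,
any pair of factors of `z₀` and `z₁` below a given factor of `s`, which gives one inclusion.
Conversely, as the alphabets are disjoint, a word `y` in the abelian closure of `substitute s z₀ z₁`
projects to a word `x` in the abelian closure of `s` and splits as `substitute x t₀ t₁`; since `x`
is again balanced of slope `a`, this word has the same factors as `substitute s t₀ t₁`.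
Periodicity of `z₀` and `z₁` leaves only finitely many `t₀` and `t₁`.
-/

namespace InfWord

variable {α : Type*}

section Block

variable {x y : ℕ → α} {i j m n : ℕ}

@[simp] theorem length_block (x : ℕ → α) (i n : ℕ) : (block x i n).length = n := by
  simp [block]

@[simp] theorem block_zero (x : ℕ → α) (i : ℕ) : block x i 0 = [] := by simp [block]

theorem block_succ (x : ℕ → α) (i n : ℕ) : block x i (n + 1) = block x i n ++ [x (i + n)] := by
  rw [block, List.ofFn_succ_last]
  simp [block]

theorem block_succ' (x : ℕ → α) (i n : ℕ) : block x i (n + 1) = x i :: block x (i + 1) n := by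
  simp [block, List.ofFn_succ, Nat.add_assoc, Nat.add_comm 1]

theorem map_block {β : Type*} (f : α → β) (x : ℕ → α) (i n : ℕ) :
    (block x i n).map f = block (f ∘ x) i n := by
  simp [block, List.map_ofFn, Function.comp_def]

theorem forall_mem_block {p : α → Prop} (h : ∀ k, p (x k)) (i n : ℕ) : ∀ c ∈ block x i n, p c := by
  simp [block, h]

theorem block_eq_block_iff : block x i n = block y j n ↔ ∀ k < n, x (i + k) = y (j + k) := by
  rw [block, block, List.ofFn_inj, funext_iff, Fin.forall_iff]

theorem block_add_eq_of_block_eq (h : block x i m = block y j m) {k : ℕ} (hk : k + n ≤ m) :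
    block x (i + k) n = block y (j + k) n := by
  rw [block_eq_block_iff] at h ⊢
  intro l hl
  simpa only [add_assoc] using h (k + l) (by omega)

theorem mem_abelianClosure_iff :
    y ∈ abelianClosure x ↔ ∀ i n, ∃ j, (block y i n).Perm (block x j n) := by
  constructor
  · intro h i n
    obtain ⟨_, ⟨j, m, rfl⟩, hperm⟩ := h _ ⟨i, n, rfl⟩
    rw [abelianEquiv_iff_perm] at hperm
    obtain rfl : n = m := by simpa only [length_block] using hperm.length_eq
    exact ⟨j, hperm⟩
  · rintro h _ ⟨i, n, rfl⟩
    obtain ⟨j, hperm⟩ := h i n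
    exact ⟨_, ⟨j, n, rfl⟩, (abelianEquiv_iff_perm _ _).2 hperm⟩

theorem mem_orbitClosure_iff : y ∈ orbitClosure x ↔ ∀ i n, ∃ j, block y i n = block x j n := by
  constructor
  · intro h i n
    obtain ⟨j, m, heq⟩ := h ⟨i, n, rfl⟩
    obtain rfl : n = m := by simpa only [length_block] using congrArg List.length heq
    exact ⟨j, heq⟩
  · rintro h _ ⟨i, n, rfl⟩
    obtain ⟨j, heq⟩ := h i n
    exact ⟨j, n, heq⟩

theorem orbitClosure_subset_orbitClosure (h : y ∈ orbitClosure x) :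
    orbitClosure y ⊆ orbitClosure x :=
  fun _ hw => Set.Subset.trans hw h

theorem orbitClosure_subset_abelianClosure (h : y ∈ abelianClosure x) :
    orbitClosure y ⊆ abelianClosure x :=
  fun _ hw v hv => h v (hw hv)

theorem comp_mem_abelianClosure {β : Type*} (f : α → β) (h : y ∈ abelianClosure x) :
    f ∘ y ∈ abelianClosure (f ∘ x) := by
  rw [mem_abelianClosure_iff] at h ⊢
  intro i n
  obtain ⟨j, hperm⟩ := h i n
  exact ⟨j, by simpa only [map_block] using hperm.map f⟩

end Block

section Syndetic

/-- A set of natural numbers with bounded gaps. -/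
def IsSyndetic (S : Set ℕ) : Prop :=
  ∃ L : ℕ, ∀ m : ℕ, ∃ j ∈ S, m ≤ j ∧ j < m + L

variable {S T : Set ℕ}

theorem IsSyndetic.nonempty (hS : IsSyndetic S) : S.Nonempty := by
  obtain ⟨L, hL⟩ := hS
  obtain ⟨j, hj, -⟩ := hL 0
  exact ⟨j, hj⟩

theorem IsSyndetic.mono (hS : IsSyndetic S) (hST : S ⊆ T) : IsSyndetic T := by
  obtain ⟨L, hL⟩ := hS
  refine ⟨L, fun m => ?_⟩
  obtain ⟨j, hj, hmem⟩ := hL m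
  exact ⟨j, hST hj, hmem⟩

theorem IsSyndetic.image_add_mul (hS : IsSyndetic S) (r : ℕ) {N : ℕ} (hN : 0 < N) :
    IsSyndetic ((fun t => r + N * t) '' S) := by
  obtain ⟨L, hL⟩ := hS
  refine ⟨r + N + N * L, fun m => ?_⟩
  obtain ⟨t, ht, hmt, htL⟩ := hL (m / N + 1)
  have hdiv : N * (m / N) ≤ m := Nat.mul_div_le m N
  have hlower : m < N * (m / N + 1) := Nat.lt_mul_div_succ m hN
  have hmt' : N * (m / N + 1) ≤ N * t := Nat.mul_le_mul_left N hmt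
  have htL' : N * t < N * (m / N + 1 + L) := Nat.mul_lt_mul_of_pos_left htL hN
  refine ⟨r + N * t, ⟨t, ht, rfl⟩, by omega, ?_⟩
  simp only [mul_add, mul_one] at htL'
  omega

theorem isSyndetic_setOf_iterate_mem {X : Type*} [TopologicalSpace X] [CompactSpace X] {f : X → X}
    (hf : Continuous f) {U : Set X} (hU : IsOpen U) (hvisit : ∀ x, ∃ t, f^[t] x ∈ U) (x : X) :
    IsSyndetic {t | f^[t] x ∈ U} := by
  obtain ⟨F, hF⟩ := isCompact_univ.elim_finite_subcover (fun t => f^[t] ⁻¹' U)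
    (fun t => hU.preimage (hf.iterate t)) fun x _ => Set.mem_iUnion.2 (hvisit x)
  refine ⟨F.sup id + 1, fun m => ?_⟩
  obtain ⟨t, htF, ht⟩ := Set.mem_iUnion₂.1 (hF (Set.mem_univ (f^[m] x)))
  have htle : t ≤ F.sup id := Finset.le_sup (f := id) htF
  refine ⟨t + m, ?_, by omega, by omega⟩
  rwa [Set.mem_ofPred_eq, Function.iterate_add_apply]

theorem isSyndetic_setOf_add_nsmul_mem {G : Type*} [AddCommGroup G] [TopologicalSpace G]
    [IsTopologicalAddGroup G] [CompactSpace G] {g : G} (hg : DenseRange (fun n : ℤ => n • g))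
    {U : Set G} (hU : IsOpen U) (hne : U.Nonempty) (θ : G) :
    IsSyndetic {t : ℕ | θ + t • g ∈ U} := by
  have hiter : ∀ (t : ℕ) (x : G), (fun w => w + g)^[t] x = x + t • g := fun t x => by
    rw [add_right_iterate]
  simp only [← hiter]
  refine isSyndetic_setOf_iterate_mem (continuous_add_const g) hU (fun x => ?_) θ
  obtain ⟨u, hu⟩ := hne
  obtain ⟨t, ht⟩ := (denseRange_zsmul_iff_nsmul.1 hg).exists_mem_open
    (hU.preimage (continuous_const_add x)) ⟨u - x, by simpa using hu⟩
  exact ⟨t, by rwa [hiter]⟩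

theorem isSyndetic_setOf_exists_mem_Ioo {a p c d : ℝ} (hp : 0 < p) (ha : Irrational (a / p))
    (hcd : c < d) (θ : ℝ) :
    IsSyndetic {t : ℕ | ∃ z : ℤ, θ + t * a - z * p ∈ Set.Ioo c d} := by
  have : Fact (0 < p) := ⟨hp⟩
  refine (isSyndetic_setOf_add_nsmul_mem (AddCircle.denseRange_zsmul_coe_iff.2 ha)
    (QuotientAddGroup.isOpenMap_coe _ isOpen_Ioo) ((Set.nonempty_Ioo.2 hcd).image _)
    (θ : AddCircle p)).mono ?_
  rintro t ⟨w, hw, hwt⟩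
  have hzero : ((θ + t * a - w : ℝ) : AddCircle p) = 0 := by
    rw [AddCircle.coe_sub, sub_eq_zero, AddCircle.coe_add, ← nsmul_eq_mul, AddCircle.coe_nsmul]
    exact hwt.symm
  obtain ⟨z, hz⟩ := (AddCircle.coe_eq_zero_iff p).1 hzero
  rw [zsmul_eq_mul] at hz
  exact ⟨z, by rwa [hz, sub_sub_cancel]⟩

end Syndetic

section Subshift

variable {x y : ℕ → α}

/-- A uniformly recurrent word: every factor occurs with bounded gaps. -/
def IsUniformlyRecurrent (x : ℕ → α) : Prop :=
  ∀ i n, IsSyndetic {j | block x j n = block x i n}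

theorem IsUniformlyRecurrent.orbitClosure_eq (hx : IsUniformlyRecurrent x)
    (hy : y ∈ orbitClosure x) : orbitClosure y = orbitClosure x := by
  refine (orbitClosure_subset_orbitClosure hy).antisymm (orbitClosure_subset_orbitClosure ?_)
  refine mem_orbitClosure_iff.2 fun i n => ?_
  obtain ⟨L, hL⟩ := hx i n
  obtain ⟨m, hm⟩ := mem_orbitClosure_iff.1 hy 0 (L + n)
  obtain ⟨j, hj, hmj, hjL⟩ := hL m
  obtain ⟨k, rfl⟩ := Nat.exists_eq_add_of_le hmj
  exact ⟨0 + k, hj.symm.trans (block_add_eq_of_block_eq hm (by omega)).symm⟩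

theorem iterate_shift_apply (y : ℕ → α) (j n : ℕ) : shift^[j] y n = y (j + n) := by
  induction j generalizing y with
  | zero => simp
  | succ j ih => rw [Function.iterate_succ_apply, ih, shift, Nat.add_right_comm]

variable [TopologicalSpace α]

theorem isClosed_orbitClosure [DiscreteTopology α] (x : ℕ → α) : IsClosed (orbitClosure x) := by
  have hinter : orbitClosure x = ⋂ (i : ℕ) (n : ℕ), (fun y (k : Fin n) => y (i + k)) ⁻¹'
      {w : Fin n → α | List.ofFn w ∈ language x} := by
    ext y
    simp only [Set.mem_iInter]
    constructor
    · exact fun h i n => h ⟨i, n, rfl⟩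
    · rintro h _ ⟨i, n, rfl⟩
      exact h i n
  rw [hinter]
  exact isClosed_iInter fun i => isClosed_iInter fun n =>
    (isClosed_discrete _).preimage (by fun_prop)

theorem isSubshift_orbitClosure [DiscreteTopology α] (x : ℕ → α) : IsSubshift (orbitClosure x) where
  nonempty := ⟨x, Set.Subset.rfl⟩
  isClosed := isClosed_orbitClosure x
  shift_mem y hy := by
    rw [mem_orbitClosure_iff] at hy ⊢
    intro i n
    obtain ⟨j, hj⟩ := hy (i + 1) n
    refine ⟨j, hj ▸ block_eq_block_iff.2 fun k _ => ?_⟩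
    rw [shift, Nat.add_right_comm]

theorem IsSubshift.orbitClosure_subset {Y : Set (ℕ → α)} (hY : IsSubshift Y) (hy : y ∈ Y) :
    orbitClosure y ⊆ Y := by
  intro x hx
  have hshift : ∀ j, shift^[j] y ∈ Y := fun j => Set.MapsTo.iterate hY.shift_mem j hy
  choose j hj using fun n => mem_orbitClosure_iff.1 hx 0 n
  have hlim : Filter.Tendsto (fun n => shift^[j n] y) Filter.atTop (nhds x) := by
    rw [tendsto_pi_nhds]
    intro k
    refine tendsto_const_nhds.congr' ?_
    filter_upwards [Filter.eventually_gt_atTop k] with n hn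
    rw [iterate_shift_apply]
    simpa only [zero_add] using block_eq_block_iff.1 (hj n) k hn
  exact hY.isClosed.mem_of_tendsto hlim (Filter.Eventually.of_forall fun n => hshift (j n))

theorem IsUniformlyRecurrent.isMinimalSubshift_orbitClosure [DiscreteTopology α]
    (hx : IsUniformlyRecurrent x) : IsMinimalSubshift (orbitClosure x) := by
  refine ⟨isSubshift_orbitClosure x, fun Y hY hYx => hYx.antisymm ?_⟩
  obtain ⟨y, hy⟩ := hY.nonempty
  exact hx.orbitClosure_eq (hYx hy) ▸ hY.orbitClosure_subset hy

end Subshift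

section Periodic

variable {z y : ℕ → α} {N i j : ℕ}

theorem apply_eq_of_modEq (hz : Function.Periodic z N) (h : i ≡ j [MOD N]) : z i = z j := by
  rw [← hz.map_mod_nat i, ← hz.map_mod_nat j, h]

theorem block_eq_of_modEq (hz : Function.Periodic z N) (h : i ≡ j [MOD N]) (n : ℕ) :
    block z i n = block z j n :=
  block_eq_block_iff.2 fun k _ => apply_eq_of_modEq hz (h.add_right k)

theorem block_perm_block (hz : Function.Periodic z N) (i j : ℕ) :
    (block z i N).Perm (block z j N) := by
  suffices h : ∀ i, (block z i N).Perm (block z 0 N) from (h i).trans (h j).symm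
  intro i
  induction i with
  | zero => rfl
  | succ i ih =>
    refine List.Perm.trans (List.Perm.cons_inv (a := z i) ?_) ih
    rw [← block_succ', block_succ, hz i]
    exact List.perm_append_singleton _ _

theorem periodic_of_block_perm_block_succ
    (h : ∀ i, (block y i N).Perm (block y (i + 1) N)) : Function.Periodic y N := by
  intro i
  have hcons : (y (i + N) :: block y (i + 1) N).Perm (y i :: block y (i + 1) N) := by
    rw [← block_succ', block_succ]
    exact ((h i).symm.cons _).trans (List.perm_append_singleton _ _).symm
  simpa using List.perm_append_right_iff (l₁ := [y (i + N)]) (l₂ := [y i]) _ |>.1 hcons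

theorem periodic_of_mem_abelianClosure (hz : Function.Periodic z N)
    (hy : y ∈ abelianClosure z) : Function.Periodic y N := by
  refine periodic_of_block_perm_block_succ fun i => ?_
  obtain ⟨j, hj⟩ := mem_abelianClosure_iff.1 hy i N
  obtain ⟨k, hk⟩ := mem_abelianClosure_iff.1 hy (i + 1) N
  exact hj.trans ((block_perm_block hz j k).trans hk.symm)

theorem IsPeriodic.of_mem_abelianClosure (hz : IsPeriodic z) (hy : y ∈ abelianClosure z) :
    IsPeriodic y := by
  obtain ⟨N, hN, hz⟩ := hz
  exact ⟨N, hN, periodic_of_mem_abelianClosure hz hy⟩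

theorem apply_mem_range_of_mem_abelianClosure (hy : y ∈ abelianClosure z) (n : ℕ) :
    y n ∈ Set.range z := by
  obtain ⟨j, hj⟩ := mem_abelianClosure_iff.1 hy n 1
  exact ⟨j, by simpa [block] using hj.symm⟩

theorem IsPeriodic.finite_range (hz : IsPeriodic z) : (Set.range z).Finite := by
  obtain ⟨N, hN, hz⟩ := hz
  refine ((Set.finite_Iio N).image z).subset ?_
  rintro _ ⟨n, rfl⟩
  exact ⟨n % N, Nat.mod_lt n hN, hz.map_mod_nat n⟩

theorem finite_setOf_periodic_and_forall_mem {S : Set α} (hS : S.Finite) (hN : 0 < N) :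
    {y : ℕ → α | Function.Periodic y N ∧ ∀ n, y n ∈ S}.Finite := by
  refine Set.Finite.of_finite_image (f := fun y (k : Fin N) => y k)
    ((Set.Finite.pi' fun _ : Fin N => hS).subset ?_) ?_
  · rintro _ ⟨y, hy, rfl⟩ k
    exact hy.2 k
  · intro y hy y' hy' h
    funext n
    rw [← hy.1.map_mod_nat n, ← hy'.1.map_mod_nat n]
    exact congrFun h ⟨n % N, Nat.mod_lt n hN⟩

theorem IsPeriodic.finite_abelianClosure (hz : IsPeriodic z) : (abelianClosure z).Finite := by
  obtain ⟨N, hN, hzN⟩ := id hz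
  exact (finite_setOf_periodic_and_forall_mem hz.finite_range hN).subset fun y hy =>
    ⟨periodic_of_mem_abelianClosure hzN hy, apply_mem_range_of_mem_abelianClosure hy⟩

end Periodic

section LetterCount

variable {β : Type*} [DecidableEq β]

/-- The number of occurrences of the letter `b` among the first `n` letters of `x`, that is, the
index of the letter that `substitute` puts in place of an occurrence of `b` at position `n`. -/
def letterCount (x : ℕ → β) (b : β) (n : ℕ) : ℕ := Nat.count (fun i => x i = b) n

theorem letterCount_add (x : ℕ → β) (b : β) (i n : ℕ) :
    letterCount x b (i + n) = letterCount x b i + (block x i n).count b := by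
  induction n with
  | zero => simp
  | succ n ih =>
    rw [block_succ, List.count_append, List.count_singleton, ← add_assoc, ← add_assoc, ← ih]
    simp only [letterCount, Nat.count_succ, beq_iff_eq]

theorem letterCount_eq_count_block (x : ℕ → β) (b : β) (n : ℕ) :
    letterCount x b n = (block x 0 n).count b := by
  simpa [letterCount] using letterCount_add x b 0 n

theorem count_zero_add_count_one (w : List (Fin 2)) : w.count 0 + w.count 1 = w.length := by
  induction w with
  | nil => rfl
  | cons c w ih =>
    obtain rfl | rfl : c = 0 ∨ c = 1 := by omega
    · rw [List.count_cons_self, List.count_cons_of_ne zero_ne_one, List.length_cons, ← ih,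
        Nat.add_right_comm]
    · rw [List.count_cons_self, List.count_cons_of_ne one_ne_zero, List.length_cons, ← ih,
        Nat.add_assoc]

theorem letterCount_zero_add_letterCount_one (x : ℕ → Fin 2) (n : ℕ) :
    letterCount x 0 n + letterCount x 1 n = n := by
  simp only [letterCount_eq_count_block, count_zero_add_count_one, length_block]

theorem block_eq_block_of_count_one_eq {x y : ℕ → Fin 2} {i j n : ℕ}
    (h : ∀ k ≤ n, (block x i k).count 1 = (block y j k).count 1) :
    block x i n = block y j n := by
  rw [block_eq_block_iff]
  intro k hk
  have hsucc := h (k + 1) hk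
  simp only [block_succ, List.count_append, h k hk.le, List.count_singleton, beq_iff_eq] at hsucc
  split_ifs at hsucc <;> omega

theorem exists_letterCount_eq_and_count_block_eq {x : ℕ → β} {b : β}
    (hinf : {n | x n = b}.Infinite) (i k : ℕ) :
    ∃ j n, letterCount x b j = i ∧ (block x j n).count b = k := by
  have hnth : ∀ m, letterCount x b (Nat.nth (fun i => x i = b) m) = m :=
    Nat.count_nth_of_infinite hinf
  obtain ⟨n, hn⟩ := Nat.exists_eq_add_of_le (Nat.nth_monotone hinf (Nat.le_add_right i k))
  refine ⟨_, n, hnth i, ?_⟩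
  have hcount := letterCount_add x b (Nat.nth (fun i => x i = b) i) n
  rw [← hn, hnth, hnth] at hcount
  omega

theorem infinite_setOf_eq_of_lt_letterCount {x : ℕ → β} {b : β} {c C : ℝ} (hc : 0 < c)
    (h : ∀ n : ℕ, n * c - C < letterCount x b n) : {n | x n = b}.Infinite := by
  intro hfin
  obtain ⟨n, hn⟩ := exists_nat_gt ((C + hfin.toFinset.card) / c)
  rw [div_lt_iff₀ hc] at hn
  have hle : (letterCount x b n : ℝ) ≤ hfin.toFinset.card := by
    exact_mod_cast Nat.count_le_card hfin n
  linarith [h n]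

end LetterCount

section Floor

variable {R : Type*} [CommRing R] [LinearOrder R] [IsStrictOrderedRing R] [FloorRing R] {a : R}

theorem floor_add_eq_ite (ha₀ : 0 ≤ a) (ha₁ : a ≤ 1) (t : R) :
    ⌊t + a⌋ = ⌊t⌋ + if 1 - a ≤ Int.fract t then 1 else 0 := by
  have hsum := Int.floor_add_fract t
  have hnonneg := Int.fract_nonneg t
  have hlt := Int.fract_lt_one t
  rw [Int.floor_eq_iff]
  split_ifs <;> push_cast <;> constructor <;> linarith

theorem ceil_add_eq_ite (ha₀ : 0 < a) (ha₁ : a ≤ 1) (t : R) :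
    ⌈t + a⌉ = ⌈t⌉ + if 1 - a < Int.fract t ∨ Int.fract t = 0 then 1 else 0 := by
  have hsum := Int.floor_add_fract t
  have hlt := Int.fract_lt_one t
  rcases (Int.fract_nonneg t).eq_or_lt' with hzero | hpos
  · have hceil : ⌈t⌉ = ⌊t⌋ := by rw [Int.ceil_eq_iff]; constructor <;> linarith
    rw [hceil, if_pos (Or.inr hzero), Int.ceil_eq_iff]
    push_cast
    constructor <;> linarith
  · have hceil : ⌈t⌉ = ⌊t⌋ + 1 := by
      rw [Int.ceil_eq_iff]; push_cast; constructor <;> linarith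
    simp only [hceil, hpos.ne', or_false, Int.ceil_eq_iff]
    split_ifs <;> push_cast <;> constructor <;> linarith

end Floor

section Slope

variable {s x y : ℕ → Fin 2} {a : ℝ}

/-- The binary word `x` is balanced of slope `a`: the number of letters `1` in each factor of length
`n` differs from `n * a` by less than one. -/
def HasSlope (x : ℕ → Fin 2) (a : ℝ) : Prop :=
  ∀ i n : ℕ, |((block x i n).count 1 : ℝ) - n * a| < 1

theorem HasSlope.of_mem_abelianClosure (hx : HasSlope x a) (hy : y ∈ abelianClosure x) :
    HasSlope y a := by
  intro i n
  obtain ⟨j, hj⟩ := mem_abelianClosure_iff.1 hy i n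
  exact hj.count_eq 1 ▸ hx j n

theorem hasSlope_of_primitive {h : ℕ → ℤ} (hstep : ∀ n, h (n + 1) = h n + if x n = 1 then 1 else 0)
    (hdisc : ∀ i n : ℕ, |(h (i + n) - h i : ℝ) - n * a| < 1) : HasSlope x a := by
  have hcount : ∀ i n, h (i + n) = h i + ((block x i n).count 1 : ℕ) := by
    intro i n
    induction n with
    | zero => simp
    | succ n ih =>
      rw [← add_assoc, hstep, ih, block_succ, List.count_append, List.count_singleton]
      simp only [beq_iff_eq, Nat.cast_add, Nat.cast_ite, Nat.cast_one, Nat.cast_zero, add_assoc]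
  intro i n
  simpa [hcount i n] using hdisc i n

theorem hasSlope_lowerRotationWord (ha₀ : 0 ≤ a) (ha₁ : a ≤ 1) (r : ℝ) :
    HasSlope (lowerRotationWord a r) a := by
  refine hasSlope_of_primitive (h := fun n => ⌊r + n * a⌋) (fun n => ?_) fun i n => ?_
  · rw [Nat.cast_succ, add_one_mul, ← add_assoc, floor_add_eq_ite ha₀ ha₁]
    simp [lowerRotationWord]
  · have hi := Int.floor_le (r + i * a)
    have hi' := Int.lt_floor_add_one (r + i * a)
    have hin := Int.floor_le (r + (i + n : ℕ) * a)
    have hin' := Int.lt_floor_add_one (r + (i + n : ℕ) * a)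
    push_cast at hin hin' ⊢
    rw [abs_lt]
    constructor <;> linarith

theorem hasSlope_upperRotationWord (ha₀ : 0 < a) (ha₁ : a ≤ 1) (r : ℝ) :
    HasSlope (upperRotationWord a r) a := by
  refine hasSlope_of_primitive (h := fun n => ⌈r + n * a⌉) (fun n => ?_) fun i n => ?_
  · rw [Nat.cast_succ, add_one_mul, ← add_assoc, ceil_add_eq_ite ha₀ ha₁]
    simp only [upperRotationWord, ite_eq_left_iff, zero_ne_one, imp_false, not_not]
  · have hi := Int.le_ceil (r + i * a)
    have hi' := Int.ceil_lt_add_one (r + i * a)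
    have hin := Int.le_ceil (r + (i + n : ℕ) * a)
    have hin' := Int.ceil_lt_add_one (r + (i + n : ℕ) * a)
    push_cast at hin hin' ⊢
    rw [abs_lt]
    constructor <;> linarith

theorem IsSturmian.exists_hasSlope (hs : IsSturmian s) :
    ∃ a ∈ Set.Ioo (0 : ℝ) 1, Irrational a ∧ HasSlope s a := by
  obtain ⟨a, r, hirr, ⟨ha₀, ha₁⟩, -, hs⟩ := hs
  have hpos : 0 < a := ha₀.lt_of_ne' hirr.ne_zero
  refine ⟨a, ⟨hpos, ha₁⟩, hirr, ?_⟩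
  rcases hs with rfl | rfl
  · exact hasSlope_lowerRotationWord ha₀ ha₁.le r
  · exact hasSlope_upperRotationWord hpos ha₁.le r

theorem HasSlope.infinite_setOf_eq (hx : HasSlope x a) (ha : a ∈ Set.Ioo (0 : ℝ) 1) (b : Fin 2) :
    {n | x n = b}.Infinite := by
  have hbound : ∀ n : ℕ, |(letterCount x 1 n : ℝ) - n * a| < 1 := fun n => by
    simpa only [letterCount_eq_count_block] using hx 0 n
  fin_cases b
  · refine infinite_setOf_eq_of_lt_letterCount (sub_pos.2 ha.2) (C := 1) fun n => ?_
    have hsum : (letterCount x 0 n : ℝ) + letterCount x 1 n = n := by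
      exact_mod_cast letterCount_zero_add_letterCount_one x n
    simp only [Fin.zero_eta]
    linarith [(abs_lt.1 (hbound n)).2]
  · refine infinite_setOf_eq_of_lt_letterCount ha.1 (C := 1) fun n => ?_
    simp only [Fin.mk_one]
    linarith [(abs_lt.1 (hbound n)).1]

theorem HasSlope.letterCount_sub_lt (hx : HasSlope x a) (j k : ℕ) :
    (letterCount x 1 j : ℝ) - j * a < letterCount x 1 k - k * a + 1 := by
  rcases le_total j k with h | h
  · obtain ⟨n, rfl⟩ := Nat.exists_eq_add_of_le h
    rw [letterCount_add]
    push_cast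
    linarith [(abs_lt.1 (hx j n)).1]
  · obtain ⟨n, rfl⟩ := Nat.exists_eq_add_of_le h
    rw [letterCount_add]
    push_cast
    linarith [(abs_lt.1 (hx k n)).2]

theorem HasSlope.exists_forall_letterCount_sub_mem_Icc (hx : HasSlope x a) :
    ∃ b : ℝ, ∀ j : ℕ, (letterCount x 1 j : ℝ) - j * a ∈ Set.Icc (b - 1) b := by
  let disc : ℕ → ℝ := fun j => letterCount x 1 j - j * a
  have hosc : ∀ j k, disc j ≤ disc k + 1 := fun j k => (hx.letterCount_sub_lt j k).le
  have hbdd : BddAbove (Set.range disc) := ⟨disc 0 + 1, Set.forall_mem_range.2 fun j => hosc j 0⟩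
  exact ⟨⨆ j, disc j, fun k =>
    ⟨sub_le_iff_le_add.2 (ciSup_le fun j => hosc j k), le_ciSup hbdd k⟩⟩

theorem HasSlope.exists_forall_count_block_sub_mem_Icc (hx : HasSlope x a) (i n : ℕ) :
    ∃ c d : ℝ, c < d ∧ ∀ k ≤ n, ((block x i k).count 1 : ℝ) - k * a ∈ Set.Icc (d - 1) c := by
  let disc : ℕ → ℝ := fun k => (block x i k).count 1 - k * a
  have hosc : ∀ k l, disc k < disc l + 1 := by
    intro k l
    have hkl := hx.letterCount_sub_lt (i + k) (i + l)
    rw [letterCount_add, letterCount_add] at hkl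
    push_cast at hkl
    linarith
  obtain ⟨u, -, hu⟩ := (Finset.range (n + 1)).exists_max_image disc ⟨0, by simp⟩
  obtain ⟨v, -, hv⟩ := (Finset.range (n + 1)).exists_min_image disc ⟨0, by simp⟩
  refine ⟨disc u, disc v + 1, hosc u v, fun k hk => ?_⟩
  have hmem : k ∈ Finset.range (n + 1) := Finset.mem_range_succ_iff.2 hk
  exact ⟨by simpa only [add_sub_cancel_right] using hv k hmem, hu k hmem⟩

theorem letterCount_eq_and_block_eq_of_mem_Ioo {b c d : ℝ} {i n j : ℕ} {w : ℤ}
    (hs : ∀ k : ℕ, (letterCount s 1 k : ℝ) - k * a ∈ Set.Icc (b - 1) b)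
    (hx : ∀ k ≤ n, ((block x i k).count 1 : ℝ) - k * a ∈ Set.Icc (d - 1) c)
    (hw : b + j * a - w ∈ Set.Ioo c d) :
    (letterCount s 1 j : ℤ) = w ∧ block s j n = block x i n := by
  have hcount : ∀ k ≤ n, (letterCount s 1 (j + k) : ℤ) = w + (block x i k).count 1 := by
    intro k hk
    obtain ⟨hs₁, hs₂⟩ := hs (j + k)
    obtain ⟨hx₁, hx₂⟩ := hx k hk
    obtain ⟨hw₁, hw₂⟩ := hw
    push_cast at hs₁ hs₂
    have hlt : ((letterCount s 1 (j + k) : ℤ) : ℝ) < (w + (block x i k).count 1 + 1 : ℤ) := by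
      push_cast; linarith
    have hgt : ((w + (block x i k).count 1 - 1 : ℤ) : ℝ) < (letterCount s 1 (j + k) : ℤ) := by
      push_cast; linarith
    rw [Int.cast_lt] at hlt hgt
    omega
  have hzero : (letterCount s 1 j : ℤ) = w := by simpa using hcount 0 (Nat.zero_le n)
  refine ⟨hzero, block_eq_block_of_count_one_eq fun k hk => ?_⟩
  have hk := hcount k hk
  rw [letterCount_add] at hk
  omega

theorem HasSlope.isSyndetic_setOf_block_eq (hs : HasSlope s a) (hx : HasSlope x a)
    (ha : Irrational a) {M N : ℕ} (hM : 0 < M) (hN : 0 < N) (i n p q : ℕ) :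
    IsSyndetic {j | block s j n = block x i n ∧
      letterCount s 0 j ≡ p [MOD M] ∧ letterCount s 1 j ≡ q [MOD N]} := by
  obtain ⟨b, hb⟩ := hs.exists_forall_letterCount_sub_mem_Icc
  obtain ⟨c, d, hcd, hwin⟩ := hx.exists_forall_count_block_sub_mem_Icc i n
  have hMN : 0 < M * N := Nat.mul_pos hM hN
  have hMN' : (0 : ℝ) < (M * N : ℕ) := Nat.cast_pos.2 hMN
  have hirr : Irrational ((M * N : ℕ) * a / (M * N : ℕ)) := by
    rwa [mul_div_cancel_left₀ a hMN'.ne']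
  refine ((isSyndetic_setOf_exists_mem_Ioo hMN' hirr hcd
    (b + (p + q) * a - q)).image_add_mul (p + q) hMN).mono ?_
  rintro _ ⟨t, ⟨z, hz⟩, rfl⟩
  obtain ⟨hone, hblock⟩ := letterCount_eq_and_block_eq_of_mem_Ioo
    (j := p + q + M * N * t) (w := q + z * (M * N : ℕ)) hb hwin (by
      convert hz using 1; push_cast; ring)
  have hq : letterCount s 1 (p + q + M * N * t) ≡ q [MOD M * N] := by
    rw [← Int.natCast_modEq_iff, hone]
    exact Int.modEq_iff_dvd.2 ⟨-z, by push_cast; ring⟩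
  have hp : letterCount s 0 (p + q + M * N * t) ≡ p [MOD M * N] := by
    refine Nat.ModEq.add_right_cancel hq ?_
    rw [letterCount_zero_add_letterCount_one]
    simp [Nat.ModEq]
  exact ⟨hblock, hp.of_mul_right N, hq.of_mul_left M⟩

end Slope

section Substitute

theorem substitute_apply_of_eq_zero {x : ℕ → Fin 2} {n : ℕ} (h : x n = 0) (z₀ z₁ : ℕ → α) :
    substitute x z₀ z₁ n = z₀ (letterCount x 0 n) :=
  if_pos h

theorem substitute_apply_of_eq_one {x : ℕ → Fin 2} {n : ℕ} (h : x n = 1) (z₀ z₁ : ℕ → α) :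
    substitute x z₀ z₁ n = z₁ (letterCount x 1 n) :=
  if_neg (by simp [h])

theorem block_substitute_perm (x : ℕ → Fin 2) (z₀ z₁ : ℕ → α) (i n : ℕ) :
    (block (substitute x z₀ z₁) i n).Perm
      (block z₀ (letterCount x 0 i) ((block x i n).count 0) ++
        block z₁ (letterCount x 1 i) ((block x i n).count 1)) := by
  induction n with
  | zero => simp
  | succ n ih =>
    rw [block_succ, block_succ, List.count_append, List.count_append]
    refine (ih.append_right _).trans ?_
    obtain hx | hx : x (i + n) = 0 ∨ x (i + n) = 1 := by omega
    · rw [substitute_apply_of_eq_zero hx, letterCount_add]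
      simp [hx, block_succ, (List.perm_append_singleton _ _).append_left]
    · rw [substitute_apply_of_eq_one hx, letterCount_add]
      simp [hx, block_succ]

theorem block_substitute_eq {x x' : ℕ → Fin 2} {z₀ z₁ : ℕ → α} {M N i j n : ℕ}
    (hz₀ : Function.Periodic z₀ M) (hz₁ : Function.Periodic z₁ N)
    (hblock : block x j n = block x' i n) (h₀ : letterCount x 0 j ≡ letterCount x' 0 i [MOD M])
    (h₁ : letterCount x 1 j ≡ letterCount x' 1 i [MOD N]) :
    block (substitute x z₀ z₁) j n = block (substitute x' z₀ z₁) i n := by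
  rw [block_eq_block_iff]
  intro k hk
  have hletter : x (j + k) = x' (i + k) := block_eq_block_iff.1 hblock k hk
  have hprefix : block x j k = block x' i k :=
    block_add_eq_of_block_eq hblock (k := 0) (by omega)
  obtain hx | hx : x (j + k) = 0 ∨ x (j + k) = 1 := by omega
  · rw [substitute_apply_of_eq_zero hx, substitute_apply_of_eq_zero (hletter ▸ hx),
      letterCount_add, letterCount_add, hprefix]
    exact apply_eq_of_modEq hz₀ (h₀.add_right _)
  · rw [substitute_apply_of_eq_one hx, substitute_apply_of_eq_one (hletter ▸ hx),
      letterCount_add, letterCount_add, hprefix]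
    exact apply_eq_of_modEq hz₁ (h₁.add_right _)

theorem comp_substitute {f : α → Fin 2} {z₀ z₁ : ℕ → α} (hf₀ : ∀ n, f (z₀ n) = 0)
    (hf₁ : ∀ n, f (z₁ n) = 1) (x : ℕ → Fin 2) : f ∘ substitute x z₀ z₁ = x := by
  funext n
  obtain hx | hx : x n = 0 ∨ x n = 1 := by omega
  · rw [Function.comp_apply, substitute_apply_of_eq_zero hx, hf₀, hx]
  · rw [Function.comp_apply, substitute_apply_of_eq_one hx, hf₁, hx]

/-- The subword of `y` at the positions where `x` has the letter `b`. The subwords for the two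
letters of a binary word `x` undo `substitute x`. -/
noncomputable def subword {β : Type*} (x : ℕ → β) (b : β) (y : ℕ → α) : ℕ → α :=
  fun n => y (Nat.nth (fun i => x i = b) n)

theorem substitute_subword (x : ℕ → Fin 2) (y : ℕ → α) :
    substitute x (subword x 0 y) (subword x 1 y) = y := by
  funext n
  obtain hx | hx : x n = 0 ∨ x n = 1 := by omega
  · rw [substitute_apply_of_eq_zero hx]
    exact congrArg y (Nat.nth_count (p := fun i => x i = 0) hx)
  · rw [substitute_apply_of_eq_one hx]
    exact congrArg y (Nat.nth_count (p := fun i => x i = 1) hx)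

theorem apply_subword_comp {β : Type*} {f : α → β} {b : β} {y : ℕ → α}
    (hinf : {n | f (y n) = b}.Infinite) (n : ℕ) : f (subword (f ∘ y) b y n) = b :=
  Nat.nth_mem_of_infinite hinf n

theorem perm_and_perm_of_append_perm_append {p : α → Prop} {u v u' v' : List α}
    (hu : ∀ c ∈ u, p c) (hu' : ∀ c ∈ u', p c) (hv : ∀ c ∈ v, ¬ p c) (hv' : ∀ c ∈ v', ¬ p c)
    (h : (u ++ v).Perm (u' ++ v')) : u.Perm u' ∧ v.Perm v' := by
  classical
  have hfilter : ∀ {w w' : List α}, (∀ c ∈ w, p c) → (∀ c ∈ w', ¬ p c) →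
      (w ++ w').filter (fun c => decide (p c)) = w := fun hw hw' => by
    rw [List.filter_append, List.filter_eq_self.2 (by simpa using hw),
      List.filter_eq_nil_iff.2 (by simpa using hw'), List.append_nil]
  have hperm : u.Perm u' := by
    simpa only [hfilter hu hv, hfilter hu' hv'] using h.filter (fun c => decide (p c))
  exact ⟨hperm, (List.perm_append_left_iff u').1 ((hperm.append_right v).symm.trans h)⟩

theorem mem_abelianClosure_of_forall_exists_perm {β : Type*} [DecidableEq β] {x : ℕ → β} {b : β}
    {t z : ℕ → α} (hinf : {n | x n = b}.Infinite)
    (h : ∀ i n, ∃ j m, (block t (letterCount x b i) ((block x i n).count b)).Perm (block z j m)) :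
    t ∈ abelianClosure z := by
  rw [mem_abelianClosure_iff]
  intro i k
  obtain ⟨i', n, rfl, rfl⟩ := exists_letterCount_eq_and_count_block_eq hinf i k
  obtain ⟨j, m, hperm⟩ := h i' n
  obtain rfl : _ = m := by simpa only [length_block] using hperm.length_eq
  exact ⟨j, hperm⟩

theorem exists_substitute_eq_of_mem_abelianClosure {f : α → Fin 2} {s : ℕ → Fin 2}
    {z₀ z₁ y : ℕ → α} (hf₀ : ∀ n, f (z₀ n) = 0) (hf₁ : ∀ n, f (z₁ n) = 1)
    (hinf : ∀ b, {n | f (y n) = b}.Infinite) (hy : y ∈ abelianClosure (substitute s z₀ z₁)) :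
    ∃ t₀ ∈ abelianClosure z₀, ∃ t₁ ∈ abelianClosure z₁, substitute (f ∘ y) t₀ t₁ = y := by
  let x : ℕ → Fin 2 := f ∘ y
  have hsplit : ∀ i n, ∃ j,
      (block (subword x 0 y) (letterCount x 0 i) ((block x i n).count 0)).Perm
        (block z₀ (letterCount s 0 j) ((block s j n).count 0)) ∧
      (block (subword x 1 y) (letterCount x 1 i) ((block x i n).count 1)).Perm
        (block z₁ (letterCount s 1 j) ((block s j n).count 1)) := by
    intro i n
    obtain ⟨j, hj⟩ := mem_abelianClosure_iff.1 hy i n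
    have hshuffle := block_substitute_perm x (subword x 0 y) (subword x 1 y) i n
    rw [substitute_subword] at hshuffle
    refine ⟨j, perm_and_perm_of_append_perm_append (p := fun c => f c = 0)
      (forall_mem_block (apply_subword_comp (hinf 0)) _ _) (forall_mem_block hf₀ _ _)
      (forall_mem_block (fun k => ?_) _ _) (forall_mem_block (fun k => by simp [hf₁]) _ _)
      (hshuffle.symm.trans (hj.trans (block_substitute_perm s z₀ z₁ j n)))⟩
    rw [apply_subword_comp (hinf 1)]
    exact one_ne_zero
  exact ⟨subword x 0 y,
    mem_abelianClosure_of_forall_exists_perm (hinf 0) fun i n =>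
      let ⟨j, h, _⟩ := hsplit i n; ⟨_, _, h⟩,
    subword x 1 y,
    mem_abelianClosure_of_forall_exists_perm (hinf 1) fun i n =>
      let ⟨j, _, h⟩ := hsplit i n; ⟨_, _, h⟩,
    substitute_subword x y⟩

end Substitute

section SturmianSubstitute

variable {s x : ℕ → Fin 2} {a : ℝ} {z₀ z₁ t₀ t₁ : ℕ → α}

theorem HasSlope.isSyndetic_setOf_block_substitute_eq (hs : HasSlope s a) (hx : HasSlope x a)
    (ha : Irrational a) (hz₀ : IsPeriodic z₀) (hz₁ : IsPeriodic z₁) (i n : ℕ) :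
    IsSyndetic {j | block (substitute s z₀ z₁) j n = block (substitute x z₀ z₁) i n} := by
  obtain ⟨M, hM, hz₀⟩ := hz₀
  obtain ⟨N, hN, hz₁⟩ := hz₁
  refine (hs.isSyndetic_setOf_block_eq hx ha hM hN i n (letterCount x 0 i)
    (letterCount x 1 i)).mono ?_
  rintro j ⟨hblock, h₀, h₁⟩
  exact block_substitute_eq hz₀ hz₁ hblock h₀ h₁

theorem HasSlope.substitute_mem_orbitClosure (hs : HasSlope s a) (hx : HasSlope x a)
    (ha : Irrational a) (hz₀ : IsPeriodic z₀) (hz₁ : IsPeriodic z₁) :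
    substitute x z₀ z₁ ∈ orbitClosure (substitute s z₀ z₁) :=
  mem_orbitClosure_iff.2 fun i n =>
    (hs.isSyndetic_setOf_block_substitute_eq hx ha hz₀ hz₁ i n).nonempty.imp fun _ h => h.symm

theorem HasSlope.isUniformlyRecurrent_substitute (hs : HasSlope s a) (ha : Irrational a)
    (hz₀ : IsPeriodic z₀) (hz₁ : IsPeriodic z₁) : IsUniformlyRecurrent (substitute s z₀ z₁) :=
  hs.isSyndetic_setOf_block_substitute_eq hs ha hz₀ hz₁

theorem HasSlope.substitute_mem_abelianClosure (hs : HasSlope s a) (hx : HasSlope x a)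
    (ha : Irrational a) (hz₀ : IsPeriodic z₀) (hz₁ : IsPeriodic z₁)
    (ht₀ : t₀ ∈ abelianClosure z₀) (ht₁ : t₁ ∈ abelianClosure z₁) :
    substitute x t₀ t₁ ∈ abelianClosure (substitute s z₀ z₁) := by
  obtain ⟨M, hM, hz₀⟩ := hz₀
  obtain ⟨N, hN, hz₁⟩ := hz₁
  refine mem_abelianClosure_iff.2 fun i n => ?_
  obtain ⟨p, hp⟩ := mem_abelianClosure_iff.1 ht₀ (letterCount x 0 i) ((block x i n).count 0)
  obtain ⟨q, hq⟩ := mem_abelianClosure_iff.1 ht₁ (letterCount x 1 i) ((block x i n).count 1)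
  obtain ⟨j, hblock, h₀, h₁⟩ := (hs.isSyndetic_setOf_block_eq hx ha hM hN i n p q).nonempty
  refine ⟨j, (block_substitute_perm x t₀ t₁ i n).trans
    (List.Perm.trans ?_ (block_substitute_perm s z₀ z₁ j n).symm)⟩
  rw [hblock, block_eq_of_modEq hz₀ h₀, block_eq_of_modEq hz₁ h₁]
  exact hp.append hq

theorem HasSlope.exists_mem_orbitClosure_substitute {f : α → Fin 2} {y : ℕ → α}
    (hs : HasSlope s a) (ha : Irrational a) (ha₀₁ : a ∈ Set.Ioo (0 : ℝ) 1)
    (hz₀ : IsPeriodic z₀) (hz₁ : IsPeriodic z₁)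
    (hf₀ : ∀ n, f (z₀ n) = 0) (hf₁ : ∀ n, f (z₁ n) = 1)
    (hy : y ∈ abelianClosure (substitute s z₀ z₁)) :
    ∃ t₀ ∈ abelianClosure z₀, ∃ t₁ ∈ abelianClosure z₁, y ∈ orbitClosure (substitute s t₀ t₁) := by
  have hx : HasSlope (f ∘ y) a :=
    hs.of_mem_abelianClosure (comp_substitute hf₀ hf₁ s ▸ comp_mem_abelianClosure f hy)
  obtain ⟨t₀, ht₀, t₁, ht₁, heq⟩ :=
    exists_substitute_eq_of_mem_abelianClosure hf₀ hf₁ (hx.infinite_setOf_eq ha₀₁) hy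
  have hmem := hs.substitute_mem_orbitClosure hx ha
    (hz₀.of_mem_abelianClosure ht₀) (hz₁.of_mem_abelianClosure ht₁)
  exact ⟨t₀, ht₀, t₁, ht₁, heq ▸ hmem⟩

theorem HasSlope.abelianClosure_substitute {f : α → Fin 2} (hs : HasSlope s a) (ha : Irrational a)
    (ha₀₁ : a ∈ Set.Ioo (0 : ℝ) 1) (hz₀ : IsPeriodic z₀) (hz₁ : IsPeriodic z₁)
    (hf₀ : ∀ n, f (z₀ n) = 0) (hf₁ : ∀ n, f (z₁ n) = 1) :
    abelianClosure (substitute s z₀ z₁) =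
      ⋃ t₀ ∈ abelianClosure z₀, ⋃ t₁ ∈ abelianClosure z₁, orbitClosure (substitute s t₀ t₁) := by
  refine Set.Subset.antisymm (fun y hy => ?_) (Set.iUnion₂_subset fun t₀ ht₀ =>
    Set.iUnion₂_subset fun t₁ ht₁ => orbitClosure_subset_abelianClosure
      (hs.substitute_mem_abelianClosure hs ha hz₀ hz₁ ht₀ ht₁))
  simpa only [Set.mem_iUnion, exists_prop] using
    hs.exists_mem_orbitClosure_substitute ha ha₀₁ hz₀ hz₁ hf₀ hf₁ hy

end SturmianSubstitute

end InfWord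

theorem mainTheorem2 {α : Type*} [TopologicalSpace α] [DiscreteTopology α]
    (A B : Set α) (hAB : Disjoint A B)
    (s : ℕ → Fin 2) (hs : InfWord.IsSturmian s)
    (z₀ z₁ : ℕ → α) (hz₀ : InfWord.IsPeriodic z₀) (hz₁ : InfWord.IsPeriodic z₁)
    (hA : ∀ n, z₀ n ∈ A) (hB : ∀ n, z₁ n ∈ B) :
    InfWord.abelianClosure (InfWord.substitute s z₀ z₁) =
        (⋃ t₀ ∈ InfWord.abelianClosure z₀, ⋃ t₁ ∈ InfWord.abelianClosure z₁,
          InfWord.orbitClosure (InfWord.substitute s t₀ t₁)) ∧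
      ∃ F : Set (Set (ℕ → α)), F.Finite ∧ (∀ X ∈ F, InfWord.IsMinimalSubshift X) ∧
        InfWord.abelianClosure (InfWord.substitute s z₀ z₁) = ⋃₀ F := by
  classical
  obtain ⟨a, ha₀₁, ha, hsa⟩ := hs.exists_hasSlope
  have hunion := hsa.abelianClosure_substitute (f := fun c => if c ∈ A then 0 else 1) ha ha₀₁
    hz₀ hz₁ (fun n => if_pos (hA n)) fun n => if_neg fun h => Set.disjoint_left.1 hAB h (hB n)
  refine ⟨hunion, Set.image2 (fun t₀ t₁ => InfWord.orbitClosure (InfWord.substitute s t₀ t₁))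
    (InfWord.abelianClosure z₀) (InfWord.abelianClosure z₁),
    hz₀.finite_abelianClosure.image2 _ hz₁.finite_abelianClosure, ?_, ?_⟩
  · rintro _ ⟨t₀, ht₀, t₁, ht₁, rfl⟩
    exact (hsa.isUniformlyRecurrent_substitute ha (hz₀.of_mem_abelianClosure ht₀)
      (hz₁.of_mem_abelianClosure ht₁)).isMinimalSubshift_orbitClosure
  · rw [hunion, Set.sUnion_eq_biUnion, Set.biUnion_image2]
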